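/- **Conventions.** A unital C*-algebra $\mathcal B$ has *real rank zero* if every self-adjoint element of $\mathcal B$ is a norm limit of self-adjoint elements of $\mathcal B$ with finite spectrum. For a subset $S$ of a unital C*-algebra $\mathcal M$, $C^*(S)$ denotes the unital C*-subalgebra of $\mathcal M$ generated by $S$. If $\pi:\mathcal B\to\mathcal M$ is a surjective unital $*$-homomorphism and $\mathcal S\subseteq\mathcal M$ is a unital C*-subalgebra, a *unital $*$-cross section for $\pi$ on $\mathcal S$* is a unital $*$-homomorphism $\gamma:\mathcal S\to\mathcal B$ with $\pi\circ\gamma=\mathrm{id}_{\mathcal S}$. For classes $\mathcal X,\mathcal Y$ of unital C*-algebras, a unital C*-algebra $\mathcal A$ is *$\mathcal X$-$\mathcal Y$ projective* if for all $\mathcal B\in\mathcal X$, $\mathcal M\in\mathcal Y$, every surjective unital $*$-homomorphism $\pi:\mathcal B\to\mathcal M$ and every unital $*$-homomorphism $\phi:\mathcal A\to\mathcal M$, there is a unital $*$-homomorphism $\psi:\mathcal A\to\mathcal B$ with $\pi\circ\psi=\phi$. It is *RR0-projective* if this holds with $\mathcal X=\mathcal Y$ the class of unital C*-algebras of real rank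 zero, and *W\*-C\*-projective* if it holds with $\mathcal X$ the class of von Neumann algebras and $\mathcal Y$ the class of all unital C*-algebras. **Theorem.** Let $\mathcal B$ be a unital C*-algebra of real rank zero, $\mathcal M\neq 0$ a unital C*-algebra, and $\pi:\mathcal B\to\mathcal M$ a surjective unital $*$-homomorphism. 1. For every countable family $(p_i)_{i\in I}$ of pairwise commuting projections in $\mathcal M$ there is a unital $*$-cross section for $\pi$ on $C^*(\{p_i: i\in I\})$. 2. Let $p_1,p_2,\ldots$ be a sequence of pairwise commuting projections in $\mathcal M$ and let $n\ge 0$. For every unital $*$-cross section $\gamma_n$ for $\pi$ on $C^*(p_1,\ldots,p_n)$ there is a unital $*$-cross section $\gamma_{n+1}$ for $\pi$ on $C^*(p_1,\ldots,p_{n+1})$ whose restriction to $C^*(p_1,\ldots,p_n)$ is $\gamma_n$. **Corollary.** If $K$ is a nonempty totally disconnected compact metric space, then $C(K)$ is RR0-projective and W\*-C\*-projective. -/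

import Mathlib

universe u v w

/-- A unital C⋆-algebra has real rank zero if every self-adjoint element is a norm limit of
self-adjoint elements with finite spectrum. -/
def RealRankZero (B : Type u) [CStarAlgebra B] : Prop :=
  ∀ a : B, IsSelfAdjoint a → a ∈ closure {b : B | IsSelfAdjoint b ∧ (spectrum ℂ b).Finite}

/-- A unital C⋆-algebra is a von Neumann algebra if it is ⋆-isomorphic to a unital ⋆-algebra of
bounded operators on some complex Hilbert space that equals its own double commutant. -/
def IsVonNeumann (B : Type u) [CStarAlgebra B] : Prop :=
  ∃ (H : Type u) (_ : NormedAddCommGroup H) (_ : InnerProductSpace ℂ H) (_ : CompleteSpace H)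
    (N : VonNeumannAlgebra H), Nonempty (B ≃⋆ₐ[ℂ] N.toStarSubalgebra)

/-- `A` is `X`-`Y` projective, for classes `X`, `Y` of unital C⋆-algebras: every unital
⋆-homomorphism from `A` into an algebra in `Y` lifts along every unital surjective
⋆-homomorphism from an algebra in `X`. (The maps `→⋆ₐ[ℂ]` are unital.) -/
def IsClassProjective (X : ∀ (B : Type u) [CStarAlgebra B], Prop)
    (Y : ∀ (M : Type v) [CStarAlgebra M], Prop) (A : Type w) [CStarAlgebra A] : Prop :=
  ∀ (B : Type u) [CStarAlgebra B] (M : Type v) [CStarAlgebra M], X B → Y M →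
    ∀ π : B →⋆ₐ[ℂ] M, Function.Surjective π →
      ∀ φ : A →⋆ₐ[ℂ] M, ∃ ψ : A →⋆ₐ[ℂ] B, π.comp ψ = φ

/-- RR0-projectivity: both classes consist of the unital C⋆-algebras of real rank zero. -/
def RR0Projective (A : Type w) [CStarAlgebra A] : Prop :=
  IsClassProjective.{u, v, w} (fun B _ => RealRankZero B) (fun M _ => RealRankZero M) A

/-- W⋆-C⋆-projectivity: the first class consists of the von Neumann algebras, the second of all
unital C⋆-algebras. -/
def WStarCStarProjective (A : Type w) [CStarAlgebra A] : Prop :=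
  IsClassProjective.{u, v, w} (fun B _ => IsVonNeumann B) (fun _ _ => True) A

/-- The unital C⋆-subalgebra of `M` generated by the set `S`. -/
noncomputable def cstarAdjoin {M : Type v} [CStarAlgebra M] (S : Set M) : StarSubalgebra ℂ M :=
  (StarAlgebra.adjoin ℂ S).topologicalClosure

theorem cstarAdjoin_mono {M : Type v} [CStarAlgebra M] {S T : Set M} (h : S ⊆ T) :
    cstarAdjoin S ≤ cstarAdjoin T :=
  StarSubalgebra.topologicalClosure_mono (StarAlgebra.adjoin_mono h)

/-- The unital C⋆-subalgebra generated by the first `n` terms `p 0, …, p (n - 1)`. -/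
noncomputable def cstarStage {M : Type v} [CStarAlgebra M] (p : ℕ → M) (n : ℕ) :
    StarSubalgebra ℂ M :=
  cstarAdjoin (p '' Set.Iio n)

theorem cstarStage_le_succ {M : Type v} [CStarAlgebra M] (p : ℕ → M) (n : ℕ) :
    cstarStage p n ≤ cstarStage p (n + 1) :=
  cstarAdjoin_mono (Set.image_mono (Set.Iio_subset_Iio n.le_succ))

/-- The unital ⋆-homomorphism `γ : S → B` is a ⋆-cross section for `π` on `S`. -/
def IsUnitalCrossSection {B : Type u} [CStarAlgebra B] {M : Type v} [CStarAlgebra M]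
    (π : B →⋆ₐ[ℂ] M) (S : StarSubalgebra ℂ M) (γ : S →⋆ₐ[ℂ] B) : Prop :=
  ∀ s : S, π (γ s) = s

/-! Both parts and the corollary rest on one property of `B`: self-adjoint units are dense among
self-adjoint elements. It holds in real rank zero (shift a finite spectrum off 0) and, by a separate
argument, in von Neumann algebras, so real rank zero of the latter is never needed.

The core is lifting a projection `q` below `π e` to a projection below `e`. Equivalently, a symmetry
that is 1 off the corner at `e` lifts to a symmetry commuting with `e`. Start with a self-adjoint
lift `b`, approximate it by a self-adjoint unit, and remove the off-diagonal blocks by a congruence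
close to the identity. The sign of the result is a symmetry whose image is near `π b`. Correcting it
by a small self-adjoint element makes the image exact and keeps invertibility; taking the sign again
gives the lift (`exists_symmetry_lift`, `exists_projection_lift`).

Commuting projections are then lifted one at a time, splitting each atom (minimal Boolean
combination) of the projections already lifted. Whenever an atom vanishes in `M`, its lift is chosen
to vanish as well. Hence `π` is injective, so isometric, on the algebra generated by the lifts, and
its inverse is the cross section. Conversely, a given cross section already supplies such lifts, so
the same induction step proves the extension statement. -/

/-- The self-adjoint units are dense among the self-adjoint elements. -/
def SelfAdjointUnitsDense (B : Type u) [CStarAlgebra B] : Prop :=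
  ∀ a : B, IsSelfAdjoint a → a ∈ closure {b : B | IsSelfAdjoint b ∧ IsUnit b}

/-- If `b` has finite spectrum, `b + t` is invertible for all but finitely many real `t`, hence for
arbitrarily small ones. -/
theorem RealRankZero.selfAdjointUnitsDense {B : Type u} [CStarAlgebra B] (h : RealRankZero B) :
    SelfAdjointUnitsDense B := by
  intro a ha
  refine closure_minimal ?_ isClosed_closure (h a ha)
  rintro b ⟨hb, hfin⟩
  have hpre : {t : ℝ | ((-t : ℝ) : ℂ) ∈ spectrum ℂ b}.Finite :=
    hfin.preimage fun x _ y _ hxy => by simpa using hxy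
  have hdense : (0 : ℝ) ∈ closure {t : ℝ | ((-t : ℝ) : ℂ) ∈ spectrum ℂ b}ᶜ :=
    (hpre.countable.dense_compl ℝ) 0
  have hcont : Continuous fun t : ℝ => b + algebraMap ℝ B t := by fun_prop
  have hmem := image_closure_subset_closure_image hcont (Set.mem_image_of_mem _ hdense)
  simp only [map_zero, add_zero] at hmem
  refine closure_mono ?_ hmem
  rintro _ ⟨t, ht, rfl⟩
  refine ⟨hb.add (IsSelfAdjoint.algebraMap B (IsSelfAdjoint.all t)), ?_⟩
  have h1 : IsUnit (algebraMap ℂ B ((-t : ℝ) : ℂ) - b) := spectrum.notMem_iff.mp ht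
  have h2 : b + algebraMap ℝ B t = -(algebraMap ℂ B ((-t : ℝ) : ℂ) - b) := by
    rw [IsScalarTower.algebraMap_apply ℝ ℂ B t]
    simp
  change IsUnit (b + algebraMap ℝ B t)
  rw [h2]
  exact h1.neg

/-! ### Signs of self-adjoint units and norm cut-downs. -/

section Sign

variable {A : Type u} [CStarAlgebra A] {M : Type v} [CStarAlgebra M]

/-- The symmetry in the polar decomposition of a self-adjoint unit. -/
noncomputable def cfcSign (z : A) : A := cfc (fun t : ℝ => t / |t|) z

theorem continuousOn_sign_spectrum {z : A} (hz : IsUnit z) :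
    ContinuousOn (fun t : ℝ => t / |t|) (spectrum ℝ z) := by
  have h0 : ∀ t ∈ spectrum ℝ z, |t| ≠ 0 := by
    intro t ht h
    rw [abs_eq_zero] at h
    subst h
    exact (spectrum.zero_notMem ℝ hz) ht
  exact continuousOn_id.div continuous_abs.continuousOn h0

theorem isSelfAdjoint_cfcSign (z : A) : IsSelfAdjoint (cfcSign z) := cfc_predicate _ _

theorem cfcSign_mul_self {z : A} (hz : IsSelfAdjoint z) (hu : IsUnit z) :
    cfcSign z * cfcSign z = 1 := by
  rw [cfcSign, ← cfc_mul _ _ z (continuousOn_sign_spectrum hu) (continuousOn_sign_spectrum hu),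
    ← cfc_one ℝ z]
  refine cfc_congr fun t ht => ?_
  have h0 : t ≠ 0 := fun h => spectrum.zero_notMem ℝ hu (h ▸ ht)
  have h1 : |t| ≠ 0 := abs_ne_zero.mpr h0
  simp only [Pi.one_apply]
  field_simp
  rw [sq_abs]

theorem Commute.cfcSign_left {z e : A} (h : Commute z e) : Commute (cfcSign z) e :=
  h.cfc_real _

theorem StarAlgHom.continuous_of_cstar (π : A →⋆ₐ[ℂ] M) : Continuous π := by
  open scoped CStarAlgebra in exact map_continuous π

theorem StarAlgHom.map_cfcSign (π : A →⋆ₐ[ℂ] M) {z : A} (hz : IsSelfAdjoint z) (hu : IsUnit z) :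
    π (cfcSign z) = cfcSign (π z) :=
  StarAlgHom.map_cfc π _ z (continuousOn_sign_spectrum hu) π.continuous_of_cstar hz (hz.map π)

/-- On the spectrum, `|t² - 1| = |sgn t - t| (1 + |t|)` and the last factor is at least 1. So an
almost-symmetry is close to its sign. -/
theorem norm_cfcSign_sub_self_le {z : A} (hz : IsSelfAdjoint z) (hu : IsUnit z) :
    ‖cfcSign z - z‖ ≤ ‖z * z - 1‖ := by
  have h1 : cfcSign z - z = cfc (fun t : ℝ => t / |t| - t) z := by
    rw [cfc_sub _ _ z (continuousOn_sign_spectrum hu) (by fun_prop), cfc_id' ℝ z, cfcSign]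
  have h2 : z * z - 1 = cfc (fun t : ℝ => t * t - 1) z := by
    rw [cfc_sub _ _ z (by fun_prop) (by fun_prop), cfc_mul _ _ z (by fun_prop) (by fun_prop),
      cfc_id' ℝ z, cfc_const_one ℝ z]
  rw [h1, h2]
  refine norm_cfc_le (norm_nonneg _) fun t ht => ?_
  refine le_trans ?_ (norm_apply_le_norm_cfc (fun t : ℝ => t * t - 1) z ht)
  have h0 : t ≠ 0 := fun h => spectrum.zero_notMem ℝ hu (h ▸ ht)
  simp only [Real.norm_eq_abs]
  rcases lt_or_gt_of_ne h0 with h | h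
  · rw [abs_of_neg h, div_neg, div_self h0]
    rw [show t * t - 1 = (-1 - t) * (1 - t) by ring, abs_mul]
    refine le_mul_of_one_le_right (abs_nonneg _) ?_
    rw [abs_of_pos (by linarith)]; linarith
  · rw [abs_of_pos h, div_self h0, show t * t - 1 = (1 - t) * (-(1 + t)) by ring, abs_mul]
    refine le_mul_of_one_le_right (abs_nonneg _) ?_
    rw [abs_neg, abs_of_pos (by linarith)]; linarith

theorem cfcSign_eq_self {z : A} (hz : IsSelfAdjoint z) (h : z * z = 1) : cfcSign z = z := by
  have := norm_cfcSign_sub_self_le hz ⟨⟨z, z, h, h⟩, rfl⟩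
  rw [h, sub_self, norm_zero] at this
  exact sub_eq_zero.mp (norm_le_zero_iff.mp this)

/-- A self-adjoint element can be cut down to the norm of its image without changing the image. -/
theorem exists_selfAdjoint_norm_le (π : A →⋆ₐ[ℂ] M) {k : A} (hk : IsSelfAdjoint k) {c : ℝ}
    (hc : ‖π k‖ ≤ c) :
    ∃ k' : A, IsSelfAdjoint k' ∧ ‖k'‖ ≤ c ∧ π k' = π k ∧ ∀ e, Commute k e → Commute k' e := by
  have hc0 : 0 ≤ c := (norm_nonneg _).trans hc
  -- Clamp to `[-c, c]`: the spectrum of `π k` already lies there, so the image is unchanged.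
  refine ⟨cfc (fun t : ℝ => max (-c) (min t c)) k, cfc_predicate _ _, ?_, ?_,
    fun e he => he.cfc_real _⟩
  · refine norm_cfc_le hc0 fun t _ => abs_le.mpr ⟨le_max_left _ _, ?_⟩
    exact max_le (by linarith) (min_le_right _ _)
  · rw [StarAlgHom.map_cfc π _ k (by fun_prop) π.continuous_of_cstar hk (hk.map π)]
    conv_rhs => rw [← cfc_id' ℝ (π k) (hk.map π)]
    refine cfc_congr fun t ht => ?_
    have := norm_apply_le_norm_cfc (fun t : ℝ => t) (π k) ht (by fun_prop) (hk.map π)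
    rw [cfc_id' ℝ (π k) (hk.map π)] at this
    have h := abs_le.mp (this.trans hc)
    simp [h.1, h.2]

end Sign

/-! ### Block elimination. -/

section Ring
variable {R : Type*} [Ring R] {e b i : R}

/-- The Schur complement computation. -/
theorem schur_conj_left (he : e * e = e) (hie : i * e = e * i)
    (hi : i * (e + (1 - e) * b * (1 - e)) = 1) :
    (1 - e * b * (1 - e) * i) * b * (1 - e) = (1 - e) * b * (1 - e) := by
  have hf : (1 - e) * (1 - e) = 1 - e := IsIdempotentElem.one_sub he
  have hef : e * (1 - e) = 0 := by noncomm_ring; simp [he]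
  have hif : i * (1 - e) = (1 - e) * i := by rw [mul_sub, sub_mul, hie]; simp
  have h1 : (1 - e) * i * b * (1 - e) = 1 - e := by
    calc (1 - e) * i * b * (1 - e) = i * ((1 - e) * b * (1 - e)) := by
          rw [← hif]; noncomm_ring
      _ = i * (e + (1 - e) * b * (1 - e)) * (1 - e) := by
          have : (e + (1 - e) * b * (1 - e)) * (1 - e) = (1 - e) * b * (1 - e) := by
            rw [add_mul, hef, mul_assoc _ (1 - e) (1 - e), hf, zero_add]
          rw [mul_assoc i, this]
      _ = 1 - e := by rw [hi, one_mul]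
  calc (1 - e * b * (1 - e) * i) * b * (1 - e)
      = b * (1 - e) - e * b * ((1 - e) * i * b * (1 - e)) := by noncomm_ring
    _ = (1 - e) * b * (1 - e) := by rw [h1]; noncomm_ring

end Ring

/-! ### Lifting symmetries and projections inside a corner. -/

section Corner

variable {B : Type u} [CStarAlgebra B] {M : Type v} [CStarAlgebra M]

open Topology Filter

/-- A self-adjoint element that is block diagonal with respect to `e`, with second block the
identity, is a limit of block diagonal self-adjoint units. -/
theorem SelfAdjointUnitsDense.exists_commute (hB : SelfAdjointUnitsDense B) {e b : B}
    (he : IsStarProjection e) (hb : IsSelfAdjoint b) (heb : (1 - e) * b = 1 - e)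
    {U : Set B} (hU : U ∈ 𝓝 b) :
    ∃ x ∈ U, IsSelfAdjoint x ∧ IsUnit x ∧ Commute x e := by
  have hee : e * e = e := he.isIdempotentElem
  have hes : star e = e := he.isSelfAdjoint
  have hfs : star (1 - e) = 1 - e := he.one_sub.isSelfAdjoint
  have hff : (1 - e) * (1 - e) = 1 - e := he.one_sub.isIdempotentElem
  have hef : e * (1 - e) = 0 := he.mul_one_sub_self
  have hfe : (1 - e) * e = 0 := he.one_sub_mul_self
  have hbe : b * (1 - e) = 1 - e := by
    have := congrArg star heb
    rwa [star_mul, hfs, hb.star_eq] at this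
  -- With `f = 1 - e`, `D x` is `f x f` completed to an element of the whole algebra by adding `e`,
  -- and `L x` is the elimination matrix clearing the block `e x f`. Both equal 1 at `b`, so near
  -- `b` they are invertible and the congruence `L x * x * star (L x)` stays in `U`.
  set D : B → B := fun x => e + (1 - e) * x * (1 - e) with hD
  set L : B → B := fun x => 1 - e * x * (1 - e) * Ring.inverse (D x) with hL
  have hDb : D b = 1 := by simp only [hD]; rw [heb, hff]; simp
  have hLb : L b = 1 := by simp only [hL]; rw [mul_assoc e, hbe, hef]; simp
  have hDc : Continuous D := by fun_prop
  have hinv : ContinuousAt (fun x => Ring.inverse (D x)) b := by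
    have h1 : ContinuousAt Ring.inverse (D b) := by
      rw [hDb]; exact NormedRing.inverse_continuousAt (1 : Bˣ)
    exact ContinuousAt.comp (f := D) h1 hDc.continuousAt
  have hLc : ContinuousAt L b := by fun_prop
  have hΦc : ContinuousAt (fun x => L x * x * star (L x)) b := by fun_prop
  have hunits : {x : B | IsUnit x} ∈ 𝓝 (1 : B) := Units.isOpen.mem_nhds isUnit_one
  have ev1 : ∀ᶠ x in 𝓝 b, IsUnit (D x) := by
    have := hDc.continuousAt (x := b)
    rw [ContinuousAt, hDb] at this
    exact this hunits
  have ev2 : ∀ᶠ x in 𝓝 b, IsUnit (L x) := by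
    rw [ContinuousAt, hLb] at hLc
    exact hLc hunits
  have ev3 : ∀ᶠ x in 𝓝 b, L x * x * star (L x) ∈ U := by
    rw [ContinuousAt, hLb, star_one, one_mul, mul_one] at hΦc
    exact hΦc hU
  obtain ⟨x, ⟨hxs, hxu⟩, h1, h2, h3⟩ :=
    ((mem_closure_iff_frequently.mp (hB b hb)).and_eventually (ev1.and (ev2.and ev3))).exists
  have hΦs : IsSelfAdjoint (L x * x * star (L x)) := hxs.conjugate (L x)
  refine ⟨_, h3, hΦs, (h2.mul hxu).mul h2.star, ?_⟩
  have hDe : Commute e (D x) := by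
    change e * (e + (1 - e) * x * (1 - e)) = (e + (1 - e) * x * (1 - e)) * e
    rw [mul_add, add_mul, mul_assoc _ (1 - e) e, hfe, ← mul_assoc e, ← mul_assoc e, hef]
    simp
  have hie : Ring.inverse (D x) * e = e * Ring.inverse (D x) := by
    obtain ⟨u, hu⟩ := h1
    rw [← hu, Ring.inverse_unit]
    rw [← hu] at hDe
    exact hDe.units_inv_right.eq.symm
  have hkey : L x * x * (1 - e) = (1 - e) * x * (1 - e) :=
    schur_conj_left hee hie (Ring.inverse_mul_cancel _ h1)
  have hLs : star (L x) * (1 - e) = 1 - e := by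
    simp only [hL, star_sub, star_mul, star_one, hes, hxs.star_eq]
    rw [sub_mul, one_mul, mul_assoc _ _ (1 - e), mul_assoc _ _ (1 - e), mul_assoc _ e (1 - e), hef]
    simp
  have hr : L x * x * star (L x) * (1 - e) = (1 - e) * x * (1 - e) := by
    rw [mul_assoc, hLs, hkey]
  have hl : (1 - e) * (L x * x * star (L x)) = (1 - e) * x * (1 - e) := by
    have := congrArg star hr
    rw [star_mul, hΦs.star_eq, hfs] at this
    rw [this, star_mul, star_mul, hfs, hxs.star_eq, mul_assoc]
  have : Commute (L x * x * star (L x)) (1 - (1 - e)) :=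
    (Commute.one_right _).sub_right (hr.trans hl.symm)
  simpa using this

theorem exists_selfAdjoint_lift {π : B →⋆ₐ[ℂ] M} (hπ : Function.Surjective π) {q : M}
    (hq : IsSelfAdjoint q) : ∃ x : B, IsSelfAdjoint x ∧ π x = q := by
  obtain ⟨y, hy⟩ := hπ q
  refine ⟨(2⁻¹ : ℝ) • (y + star y), (IsSelfAdjoint.all _).smul (IsSelfAdjoint.add_star_self y), ?_⟩
  have : π ((2⁻¹ : ℝ) • (y + star y)) = (2⁻¹ : ℝ) • (π y + star (π y)) := by
    rw [← map_star, ← map_add]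
    exact map_real_smul π π.continuous_of_cstar _ _
  rw [this, hy, hq.star_eq, ← two_smul ℝ q, smul_smul]
  norm_num

/-- A symmetry in the image which is the identity outside of the corner at `e` lifts to a symmetry
commuting with `e`. -/
theorem SelfAdjointUnitsDense.exists_symmetry_lift (hB : SelfAdjointUnitsDense B)
    (π : B →⋆ₐ[ℂ] M) {e b : B} (he : IsStarProjection e) (hb : IsSelfAdjoint b)
    (heb : (1 - e) * b = 1 - e) (hw : π b * π b = 1) :
    ∃ s : B, IsSelfAdjoint s ∧ s * s = 1 ∧ Commute s e ∧ π s = π b := by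
  have hfs : star (1 - e) = 1 - e := he.one_sub.isSelfAdjoint
  have hbe : b * (1 - e) = 1 - e := by
    have := congrArg star heb
    rwa [star_mul, hfs, hb.star_eq] at this
  have hbce : Commute b e := by
    have : Commute b (1 - (1 - e)) := (Commute.one_right _).sub_right (hbe.trans heb.symm)
    simpa using this
  have hc : Continuous fun x : B => ‖π x * π x - 1‖ + ‖π x - π b‖ := by
    have := π.continuous_of_cstar
    fun_prop
  -- The two terms bound the distance from the image of `cfcSign x` to `π b`; any bound below 1
  -- would do.
  have hU : {x : B | ‖π x * π x - 1‖ + ‖π x - π b‖ < 1 / 2} ∈ 𝓝 b := by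
    refine (isOpen_lt hc continuous_const).mem_nhds ?_
    simp [hw]
  obtain ⟨x, hx, hxs, hxu, hxe⟩ := hB.exists_commute he hb heb hU
  have hnear : ‖π (b - cfcSign x)‖ ≤ 1 / 2 := by
    rw [map_sub, π.map_cfcSign hxs hxu, norm_sub_rev]
    calc ‖cfcSign (π x) - π b‖ ≤ ‖cfcSign (π x) - π x‖ + ‖π x - π b‖ :=
          norm_sub_le_norm_sub_add_norm_sub _ _ _
      _ ≤ ‖π x * π x - 1‖ + ‖π x - π b‖ := by
        gcongr
        exact norm_cfcSign_sub_self_le (hxs.map π) (hxu.map π)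
      _ ≤ 1 / 2 := le_of_lt hx
  obtain ⟨k, hks, hkn, hkπ, hkc⟩ :=
    exists_selfAdjoint_norm_le π (hb.sub (isSelfAdjoint_cfcSign x)) hnear
  have hss := cfcSign_mul_self hxs hxu
  have hke : Commute k e := hkc e (hbce.sub_left hxe.cfcSign_left)
  -- A perturbation of norm less than 1 of a symmetry is invertible, by the Neumann series.
  have hzu : IsUnit (cfcSign x + k) := by
    nontriviality B
    have h1 : cfcSign x + k = cfcSign x * (1 - -(cfcSign x * k)) := by
      rw [sub_neg_eq_add, mul_add, mul_one, ← mul_assoc, hss, one_mul]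
    have h2 : ‖-(cfcSign x * k)‖ < 1 := by
      have hn : ‖cfcSign x‖ * ‖cfcSign x‖ = 1 := by
        rw [← CStarRing.norm_star_mul_self, (isSelfAdjoint_cfcSign x).star_eq, hss, norm_one]
      have hn' : ‖cfcSign x‖ ≤ 1 := by nlinarith [norm_nonneg (cfcSign x)]
      rw [norm_neg]
      calc ‖cfcSign x * k‖ ≤ ‖cfcSign x‖ * ‖k‖ := norm_mul_le _ _
        _ ≤ 1 * (1 / 2) := by gcongr
        _ < 1 := by norm_num
    rw [h1]
    exact IsUnit.mul ⟨⟨_, _, hss, hss⟩, rfl⟩ (isUnit_one_sub_of_norm_lt_one h2)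
  have hzs : IsSelfAdjoint (cfcSign x + k) := (isSelfAdjoint_cfcSign x).add hks
  have hπz : π (cfcSign x + k) = π b := by rw [map_add, hkπ, map_sub]; abel
  refine ⟨cfcSign (cfcSign x + k), isSelfAdjoint_cfcSign _, cfcSign_mul_self hzs hzu,
    (hxe.cfcSign_left.add_left hke).cfcSign_left, ?_⟩
  rw [π.map_cfcSign hzs hzu, hπz, cfcSign_eq_self (hb.map π) hw]

/-- Projections lift along surjections, inside of any corner. -/
theorem SelfAdjointUnitsDense.exists_projection_lift (hB : SelfAdjointUnitsDense B)
    {π : B →⋆ₐ[ℂ] M} (hπ : Function.Surjective π) {e : B} (he : IsStarProjection e) {q : M}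
    (hq : IsStarProjection q) (hqe : q * π e = q) :
    ∃ r : B, IsStarProjection r ∧ r * e = r ∧ π r = q := by
  have hee : e * e = e := he.isIdempotentElem
  have hes : star e = e := he.isSelfAdjoint
  have hqq : q * q = q := hq.isIdempotentElem
  have hEE : π e * π e = π e := by rw [← map_mul, hee]
  have heq : π e * q = q := by
    have := congrArg star hqe
    rwa [star_mul, hq.isSelfAdjoint.star_eq, ← map_star, hes] at this
  obtain ⟨y, hys, hyπ⟩ := exists_selfAdjoint_lift hπ hq.isSelfAdjoint
  -- `2y - 1` compressed to the corner at `e`, plus the identity of the complementary corner; its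
  -- image is a symmetry.
  set b : B := 2 * (e * y * e) + 1 - 2 * e with hbdef
  have hxs : IsSelfAdjoint (e * y * e) := by simpa [hes] using hys.conjugate e
  have hbs : IsSelfAdjoint b := by
    have h3 : ∀ z : B, IsSelfAdjoint z → IsSelfAdjoint (2 * z) := fun z hz => by
      rw [two_mul]; exact hz.add hz
    exact ((h3 _ hxs).add (IsSelfAdjoint.one B)).sub (h3 _ he.isSelfAdjoint)
  have heb : (1 - e) * b = 1 - e := by
    have h4 : (1 - e) * e = 0 := he.one_sub_mul_self
    have h5 : b = 1 + e * (2 * (y * e) - 2) := by rw [hbdef]; noncomm_ring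
    rw [h5, mul_add, ← mul_assoc, h4]; simp
  have hπb : π b = 2 * q + 1 - 2 * π e := by
    rw [hbdef]
    simp only [map_sub, map_add, map_mul, map_ofNat, map_one, hyπ]
    rw [heq, hqe]
  have hw : π b * π b = 1 := by
    rw [hπb]
    have : (2 * q + 1 - 2 * π e) * (2 * q + 1 - 2 * π e) = 1 + 4 * (q * q) + 4 * q
      - 4 * (q * π e) - 4 * (π e * q) - 4 * π e + 4 * (π e * π e) := by noncomm_ring
    rw [this, hqq, hqe, heq, hEE]; noncomm_ring
  obtain ⟨s, hss, hs1, hse, hsπ⟩ := hB.exists_symmetry_lift π he hbs heb hw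
  have hse' : s * e = e * s := hse
  -- The spectral projection of `s` for the eigenvalue 1, cut down to the corner at `e`.
  refine ⟨(2⁻¹ : ℂ) • (e + e * s), ⟨?_, ?_⟩, ?_, ?_⟩
  · have h6 : (e + e * s) * (e + e * s) = (2 : ℂ) • (e + e * s) := by
      have h7 : e * s * e = e * s := by rw [mul_assoc, hse', ← mul_assoc, hee]
      have h8 : e * s * (e * s) = e := by rw [← mul_assoc, h7, mul_assoc, hs1, mul_one]
      rw [two_smul, add_mul, mul_add, mul_add, h7, h8, hee, ← mul_assoc, hee]
      abel
    change (2⁻¹ : ℂ) • (e + e * s) * (2⁻¹ : ℂ) • (e + e * s) = _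
    rw [smul_mul_smul_comm, h6, smul_smul]
    norm_num
  · change star _ = _
    simp [star_smul, hes, hss.star_eq, hse']
  · rw [smul_mul_assoc, add_mul, hee, mul_assoc, hse', ← mul_assoc, hee]
  · have h9 : π e * (2 * q + 1 - 2 * π e) = 2 * (π e * q) + π e - 2 * (π e * π e) := by
      noncomm_ring
    rw [map_smul, map_add, map_mul, hsπ, hπb, h9, heq, hEE]
    rw [show π e + (2 * q + π e - 2 * π e) = (2 : ℂ) • q by rw [two_smul]; noncomm_ring, smul_smul]
    norm_num

end Corner

/-! ### Atoms of finitely many commuting projections. -/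

section Atoms

variable {R : Type*} [Ring R]

/-- The product of the factors `P i` for `i ∈ s` and `1 - P i` for `i ∉ s`, where `i < n`. -/
def projAtom (P : ℕ → R) (s : Finset ℕ) : ℕ → R
  | 0 => 1
  | n + 1 => projAtom P s n * if n ∈ s then P n else 1 - P n

theorem projAtom_succ_of_mem (P : ℕ → R) {s : Finset ℕ} {n : ℕ} (h : n ∈ s) :
    projAtom P s (n + 1) = projAtom P s n * P n := by simp [projAtom, h]

theorem projAtom_succ_of_notMem (P : ℕ → R) {s : Finset ℕ} {n : ℕ} (h : n ∉ s) :
    projAtom P s (n + 1) = projAtom P s n * (1 - P n) := by simp [projAtom, h]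

theorem projAtom_congr {P Q : ℕ → R} {s t : Finset ℕ} {n : ℕ} (h : ∀ i < n, P i = Q i)
    (hst : ∀ i < n, i ∈ s ↔ i ∈ t) : projAtom P s n = projAtom Q t n := by
  induction n with
  | zero => rfl
  | succ n ih =>
    rw [projAtom, projAtom, ih (fun i hi => h i (by omega)) (fun i hi => hst i (by omega)),
      h n (by omega)]
    simp only [hst n (by omega)]

theorem map_projAtom {S F : Type*} [Ring S] [FunLike F R S] [RingHomClass F R S] (f : F)
    (P : ℕ → R) (s : Finset ℕ) (n : ℕ) :
    f (projAtom P s n) = projAtom (fun i => f (P i)) s n := by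
  induction n with
  | zero => simp [projAtom]
  | succ n ih => simp only [projAtom, map_mul, ih]; split_ifs <;> simp

theorem Commute.projAtom_right {P : ℕ → R} {x : R} {n : ℕ} (h : ∀ i < n, Commute x (P i))
    (s : Finset ℕ) : Commute x (projAtom P s n) := by
  induction n with
  | zero => exact Commute.one_right x
  | succ n ih =>
    rw [projAtom]
    refine (ih fun i hi => h i (by omega)).mul_right ?_
    split_ifs
    · exact h n (by omega)
    · exact (Commute.one_right x).sub_right (h n (by omega))

theorem sum_projAtom (P : ℕ → R) (n : ℕ) :
    ∑ s ∈ (Finset.range n).powerset, projAtom P s n = 1 := by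
  induction n with
  | zero => simp [projAtom]
  | succ n ih =>
    rw [Finset.range_add_one, Finset.sum_powerset_insert Finset.notMem_range_self,
      ← Finset.sum_add_distrib, ← ih]
    refine Finset.sum_congr rfl fun s hs => ?_
    have hn : n ∉ s := fun h => Finset.notMem_range_self (Finset.mem_powerset.mp hs h)
    rw [projAtom_succ_of_notMem P hn, projAtom_succ_of_mem P (Finset.mem_insert_self n s),
      projAtom_congr (P := P) (Q := P) (s := insert n s) (t := s) (fun _ _ => rfl)
        (fun i hi => by simp [hi.ne])]
    noncomm_ring

/-- `P 0, …, P (n - 1)` are pairwise commuting projections. -/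
def CommutingProjections [StarRing R] (P : ℕ → R) (n : ℕ) : Prop :=
  (∀ i < n, IsStarProjection (P i)) ∧ ∀ i < n, ∀ j < n, Commute (P i) (P j)

namespace CommutingProjections

variable [StarRing R] {P : ℕ → R} {n : ℕ}

theorem mono (h : CommutingProjections P n) {m : ℕ} (hm : m ≤ n) : CommutingProjections P m :=
  ⟨fun i hi => h.1 i (by omega), fun i hi j hj => h.2 i (by omega) j (by omega)⟩

theorem commute_projAtom (h : CommutingProjections P n) (s : Finset ℕ) {i : ℕ} (hi : i < n) :
    Commute (P i) (projAtom P s n) :=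
  Commute.projAtom_right (fun j hj => h.2 i hi j hj) s

theorem isStarProjection_projAtom (h : CommutingProjections P n) (s : Finset ℕ) :
    IsStarProjection (projAtom P s n) := by
  induction n with
  | zero => exact IsStarProjection.one R
  | succ n ih =>
    have hc : Commute (projAtom P s n) (P n) :=
      (Commute.projAtom_right (fun j hj => h.2 n (by omega) j (by omega)) s).symm
    have key : ∀ q, IsStarProjection q → Commute (projAtom P s n) q →
        IsStarProjection (projAtom P s n * q) := fun q hq hcq =>
      ⟨(ih (h.mono n.le_succ)).isIdempotentElem.mul_of_commute hcq hq.isIdempotentElem,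
        (IsSelfAdjoint.commute_iff (ih (h.mono n.le_succ)).isSelfAdjoint hq.isSelfAdjoint).mp hcq⟩
    rw [projAtom]
    split_ifs
    · exact key _ (h.1 n (by omega)) hc
    · exact key _ (h.1 n (by omega)).one_sub ((Commute.one_right _).sub_right hc)

theorem projAtom_mul (h : CommutingProjections P n) {s : Finset ℕ} {i : ℕ} (hi : i < n) :
    projAtom P s n * P i = if i ∈ s then projAtom P s n else 0 := by
  induction n with
  | zero => omega
  | succ n ih =>
    rcases Nat.lt_succ_iff_lt_or_eq.mp hi with hlt | rfl
    · have hc : Commute (P n) (P i) := h.2 n (by omega) i hi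
      have hc' : Commute (if n ∈ s then P n else 1 - P n) (P i) := by
        split_ifs
        · exact hc
        · exact (Commute.one_left _).sub_left hc
      rw [projAtom, mul_assoc, hc'.eq, ← mul_assoc, ih (h.mono n.le_succ) hlt]
      split_ifs <;> simp
    · rw [projAtom, mul_assoc]
      split_ifs
      · rw [(h.1 i hi).isIdempotentElem.eq]
      · rw [(h.1 i hi).one_sub_mul_self, mul_zero]

theorem mul_projAtom (h : CommutingProjections P n) {s : Finset ℕ} {i : ℕ} (hi : i < n) :
    P i * projAtom P s n = if i ∈ s then projAtom P s n else 0 := by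
  rw [(h.commute_projAtom s hi).eq, h.projAtom_mul hi]

theorem projAtom_mul_projAtom (h : CommutingProjections P n) {s t : Finset ℕ}
    (hs : s ∈ (Finset.range n).powerset) (ht : t ∈ (Finset.range n).powerset) (hst : s ≠ t) :
    projAtom P s n * projAtom P t n = 0 := by
  rw [Finset.mem_powerset] at hs ht
  obtain ⟨i, hi⟩ : ∃ i, ¬(i ∈ s ↔ i ∈ t) := by
    by_contra! hcon
    exact hst (Finset.ext hcon)
  have hin : i < n := by
    by_contra hcon
    exact hi ⟨fun h => absurd (Finset.mem_range.mp (hs h)) hcon,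
      fun h => absurd (Finset.mem_range.mp (ht h)) hcon⟩
  have h1 := h.projAtom_mul (s := s) hin
  have h2 := h.mul_projAtom (s := t) hin
  by_cases his : i ∈ s
  · have hit : i ∉ t := fun h => hi ⟨fun _ => h, fun _ => his⟩
    rw [if_pos his] at h1
    rw [if_neg hit] at h2
    rw [← h1, mul_assoc, h2, mul_zero]
  · have hit : i ∈ t := by
      by_contra h
      exact hi ⟨fun h' => absurd h' his, fun h' => absurd h' h⟩
    rw [if_neg his] at h1
    rw [if_pos hit] at h2
    rw [← h2, ← mul_assoc, h1, zero_mul]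

end CommutingProjections

end Atoms

/-! ### The finite-dimensional algebra generated by the projections. -/

section Adjoin

variable {A : Type u} [CStarAlgebra A] {P : ℕ → A} {n : ℕ}

namespace CommutingProjections

/-- Each generator acts on an atom as 0 or 1. Multiplication on both sides is tracked because the
adjoint exchanges the sides. -/
theorem adjoin_mul_projAtom (h : CommutingProjections P n) {x : A}
    (hx : x ∈ StarAlgebra.adjoin ℂ (P '' Set.Iio n)) (s : Finset ℕ) :
    ∃ c : ℂ, x * projAtom P s n = c • projAtom P s n ∧
      projAtom P s n * x = c • projAtom P s n := by
  induction hx using StarAlgebra.adjoin_induction with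
  | mem x hx =>
    obtain ⟨i, hi, rfl⟩ := hx
    refine ⟨if i ∈ s then 1 else 0, ?_, ?_⟩
    · rw [h.mul_projAtom hi]; split_ifs <;> simp
    · rw [h.projAtom_mul hi]; split_ifs <;> simp
  | algebraMap r =>
    exact ⟨r, by rw [Algebra.smul_def], by rw [Algebra.smul_def, Algebra.commutes]⟩
  | add x y _ _ hx hy =>
    obtain ⟨c, h1, h2⟩ := hx
    obtain ⟨d, h3, h4⟩ := hy
    exact ⟨c + d, by rw [add_mul, h1, h3, add_smul], by rw [mul_add, h2, h4, add_smul]⟩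
  | mul x y _ _ hx hy =>
    obtain ⟨c, h1, h2⟩ := hx
    obtain ⟨d, h3, h4⟩ := hy
    refine ⟨c * d, ?_, ?_⟩
    · rw [mul_assoc, h3, mul_smul_comm, h1, smul_smul, mul_comm]
    · rw [← mul_assoc, h2, smul_mul_assoc, h4, smul_smul]
  | star x _ hx =>
    obtain ⟨c, h1, h2⟩ := hx
    have hs := (h.isStarProjection_projAtom s).isSelfAdjoint.star_eq
    refine ⟨star c, ?_, ?_⟩
    · simpa [hs] using congrArg star h2
    · simpa [hs] using congrArg star h1

theorem exists_eq_sum_smul_projAtom (h : CommutingProjections P n) {x : A}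
    (hx : x ∈ StarAlgebra.adjoin ℂ (P '' Set.Iio n)) :
    ∃ c : Finset ℕ → ℂ, (∀ s, x * projAtom P s n = c s • projAtom P s n) ∧
      x = ∑ s ∈ (Finset.range n).powerset, c s • projAtom P s n := by
  choose c hc using h.adjoin_mul_projAtom hx
  refine ⟨c, fun s => (hc s).1, ?_⟩
  conv_lhs => rw [← mul_one x, ← sum_projAtom P n, Finset.mul_sum]
  exact Finset.sum_congr rfl fun s _ => (hc s).1

theorem isClosed_adjoin (h : CommutingProjections P n) :
    IsClosed (StarAlgebra.adjoin ℂ (P '' Set.Iio n) : Set A) := by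
  set V : Submodule ℂ A := (StarAlgebra.adjoin ℂ (P '' Set.Iio n)).toSubalgebra.toSubmodule
  set W : Submodule ℂ A :=
    Submodule.span ℂ ((fun s => projAtom P s n) '' (Finset.range n).powerset)
  have hW : FiniteDimensional ℂ W :=
    FiniteDimensional.span_of_finite ℂ ((Finset.finite_toSet _).image _)
  have hle : V ≤ W := by
    intro x hx
    obtain ⟨c, -, hc⟩ := h.exists_eq_sum_smul_projAtom (x := x) hx
    rw [hc]
    exact Submodule.sum_mem _ fun s hs =>
      Submodule.smul_mem _ _ (Submodule.subset_span ⟨s, hs, rfl⟩)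
  have hV : FiniteDimensional ℂ V := Submodule.finiteDimensional_of_le hle
  exact V.closed_of_finiteDimensional

/-- A ⋆-homomorphism that kills no nonzero atom is isometric on the algebra generated by the
projections. -/
theorem norm_map_adjoin (h : CommutingProjections P n) {M : Type v} [CStarAlgebra M]
    (π : A →⋆ₐ[ℂ] M) (hπ : ∀ s, π (projAtom P s n) = 0 → projAtom P s n = 0) {x : A}
    (hx : x ∈ StarAlgebra.adjoin ℂ (P '' Set.Iio n)) : ‖π x‖ = ‖x‖ := by
  -- Closedness makes the generated algebra a C⋆-algebra, where injective ⋆-homomorphisms are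
  -- isometric.
  have : IsClosed (StarAlgebra.adjoin ℂ (P '' Set.Iio n) : Set A) := h.isClosed_adjoin
  have hinj : Function.Injective (π.comp (StarAlgebra.adjoin ℂ (P '' Set.Iio n)).subtype) := by
    rw [injective_iff_map_eq_zero]
    rintro ⟨y, hy⟩ hy0
    replace hy0 : π y = 0 := hy0
    obtain ⟨c, hc, hsum⟩ := h.exists_eq_sum_smul_projAtom hy
    refine Subtype.ext ?_
    change y = 0
    rw [hsum]
    refine Finset.sum_eq_zero fun s _ => ?_
    have h0 : c s • π (projAtom P s n) = 0 := by
      rw [← map_smul, ← hc s, map_mul, hy0, zero_mul]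
    rcases smul_eq_zero.mp h0 with h1 | h1
    · rw [h1, zero_smul]
    · rw [hπ s h1, smul_zero]
  exact NonUnitalStarAlgHom.norm_map _ hinj ⟨x, hx⟩

end CommutingProjections

end Adjoin

/-! ### Inductive lifting without kernel. -/

section Lift

variable {B : Type u} [CStarAlgebra B] {M : Type v} [CStarAlgebra M]

/-- `P 0, …, P (n - 1)` are commuting projections lifting `p 0, …, p (n - 1)`, with no
nonzero atom in the kernel. -/
structure FaithfulLift (π : B →⋆ₐ[ℂ] M) (p : ℕ → M) (P : ℕ → B) (n : ℕ) : Prop where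
  commutingProjections : CommutingProjections P n
  map_eq : ∀ i < n, π (P i) = p i
  atom_eq_zero : ∀ s, projAtom p s n = 0 → projAtom P s n = 0

theorem FaithfulLift.zero [Nontrivial M] (π : B →⋆ₐ[ℂ] M) (p : ℕ → M) (P : ℕ → B) :
    FaithfulLift π p P 0 :=
  ⟨⟨fun i hi => by omega, fun i hi => by omega⟩, fun i hi => by omega,
    fun _ h => absurd h one_ne_zero⟩

theorem FaithfulLift.congr {π : B →⋆ₐ[ℂ] M} {p : ℕ → M} {P Q : ℕ → B} {n : ℕ}
    (h : FaithfulLift π p P n) (hPQ : ∀ i < n, P i = Q i) : FaithfulLift π p Q n where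
  commutingProjections := ⟨fun i hi => hPQ i hi ▸ h.commutingProjections.1 i hi,
    fun i hi j hj => hPQ i hi ▸ hPQ j hj ▸ h.commutingProjections.2 i hi j hj⟩
  map_eq i hi := hPQ i hi ▸ h.map_eq i hi
  atom_eq_zero s hs := by
    rw [← projAtom_congr hPQ (fun _ _ => Iff.rfl)]
    exact h.atom_eq_zero s hs

theorem FaithfulLift.map_projAtom {π : B →⋆ₐ[ℂ] M} {p : ℕ → M} {P : ℕ → B} {n : ℕ}
    (h : FaithfulLift π p P n) (s : Finset ℕ) : π (projAtom P s n) = projAtom p s n := by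
  rw [_root_.map_projAtom]
  exact projAtom_congr h.map_eq fun _ _ => Iff.rfl

/-- Each atom below is split by lifting its product with `p n` into the corner of the lifted atom.
If one half vanishes in `M`, the lift is forced to be 0 or the whole atom, which preserves
faithfulness. The pieces are orthogonal, so their sum is a projection; it commutes with the old ones
because these act as scalars on each atom. -/
theorem FaithfulLift.exists_succ {π : B →⋆ₐ[ℂ] M} {p : ℕ → M} {P : ℕ → B} {n : ℕ}
    (h : FaithfulLift π p P n) (hB : SelfAdjointUnitsDense B) (hπ : Function.Surjective π)
    (hp : CommutingProjections p (n + 1)) :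
    ∃ Q : ℕ → B, FaithfulLift π p Q (n + 1) ∧ ∀ i < n, Q i = P i := by
  have hP := h.commutingProjections
  have hpn := hp.1 n (by omega)
  have hp' := hp.mono n.le_succ
  have hE := hP.isStarProjection_projAtom
  have hex : ∀ s : Finset ℕ, ∃ r : B, IsStarProjection r ∧ r * projAtom P s n = r ∧
      π r = projAtom p s n * p n ∧ (projAtom p s n * p n = 0 → r = 0) ∧
      (projAtom p s n * (1 - p n) = 0 → projAtom P s n - r = 0) := by
    intro s
    have hf := hp'.isStarProjection_projAtom s
    have hc : Commute (projAtom p s n) (p n) :=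
      (Commute.projAtom_right (fun j hj => hp.2 n (by omega) j (by omega)) s).symm
    by_cases h0 : projAtom p s n * p n = 0
    · refine ⟨0, IsStarProjection.zero B, zero_mul _, by rw [h0, map_zero], fun _ => rfl, ?_⟩
      intro h1
      rw [mul_sub, h0, mul_one, sub_zero] at h1
      rw [h.atom_eq_zero s h1, sub_zero]
    by_cases h1 : projAtom p s n * (1 - p n) = 0
    · refine ⟨projAtom P s n, hE s, (hE s).isIdempotentElem, ?_, fun h2 => absurd h2 h0,
        fun _ => sub_self _⟩
      rw [h.map_projAtom]
      rw [mul_sub, mul_one, sub_eq_zero] at h1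
      exact h1
    · obtain ⟨r, hr, hre, hrπ⟩ := hB.exists_projection_lift hπ (hE s)
        (q := projAtom p s n * p n)
        ⟨hf.isIdempotentElem.mul_of_commute hc hpn.isIdempotentElem,
          (IsSelfAdjoint.commute_iff hf.isSelfAdjoint hpn.isSelfAdjoint).mp hc⟩
        (by rw [h.map_projAtom, mul_assoc, ← hc.eq, ← mul_assoc, hf.isIdempotentElem.eq])
      exact ⟨r, hr, hre, hrπ, fun h2 => absurd h2 h0, fun h2 => absurd h2 h1⟩
  choose r hr hre hrπ hr0 hr1 using hex
  have her : ∀ s, projAtom P s n * r s = r s := fun s => by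
    have := congrArg star (hre s)
    rwa [star_mul, (hr s).isSelfAdjoint.star_eq, (hE s).isSelfAdjoint.star_eq] at this
  set ρ : B := ∑ s ∈ (Finset.range n).powerset, r s with hρ
  have hEρ : ∀ s ∈ (Finset.range n).powerset, projAtom P s n * ρ = r s := by
    intro s hs
    rw [hρ, Finset.mul_sum, Finset.sum_eq_single_of_mem s hs, her]
    intro t ht hts
    rw [← her t, ← mul_assoc, hP.projAtom_mul_projAtom hs ht hts.symm, zero_mul]
  have hρproj : IsStarProjection ρ := by
    refine ⟨?_, isSelfAdjoint_sum _ fun s _ => (hr s).isSelfAdjoint⟩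
    change ρ * ρ = ρ
    conv_lhs => rw [hρ, Finset.sum_mul]
    rw [hρ]
    refine Finset.sum_congr rfl fun s hs => ?_
    rw [← hρ]
    calc r s * ρ = r s * (projAtom P s n * ρ) := by rw [← mul_assoc, hre]
      _ = r s := by rw [hEρ s hs, (hr s).isIdempotentElem.eq]
  have hcomm : ∀ i < n, Commute (P i) ρ := by
    intro i hi
    refine Commute.sum_right _ _ _ fun s _ => ?_
    change P i * r s = r s * P i
    have h1 : P i * r s = (P i * projAtom P s n) * r s := by rw [mul_assoc, her]
    have h2 : r s * P i = r s * (projAtom P s n * P i) := by rw [← mul_assoc, hre]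
    rw [h1, h2, hP.mul_projAtom hi, hP.projAtom_mul hi]
    split_ifs
    · rw [her, hre]
    · simp
  have hπρ : π ρ = p n := by
    rw [hρ, map_sum, Finset.sum_congr rfl fun s _ => hrπ s, ← Finset.sum_mul, sum_projAtom, one_mul]
  have hagree : ∀ i < n, Function.update P n ρ i = P i := fun i hi =>
    Function.update_of_ne hi.ne _ _
  have hnew : Function.update P n ρ n = ρ := Function.update_self _ _ _
  refine ⟨Function.update P n ρ, ⟨⟨?_, ?_⟩, ?_, ?_⟩, hagree⟩
  · intro i hi
    rcases Nat.lt_succ_iff_lt_or_eq.mp hi with hlt | rfl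
    · rw [hagree i hlt]; exact hP.1 i hlt
    · rwa [hnew]
  · intro i hi j hj
    rcases Nat.lt_succ_iff_lt_or_eq.mp hi with hlt | rfl <;>
      rcases Nat.lt_succ_iff_lt_or_eq.mp hj with hlt' | rfl
    · rw [hagree i hlt, hagree j hlt']; exact hP.2 i hlt j hlt'
    · rw [hagree i hlt, hnew]; exact hcomm i hlt
    · rw [hagree j hlt', hnew]; exact (hcomm j hlt').symm
    · exact Commute.refl _
  · intro i hi
    rcases Nat.lt_succ_iff_lt_or_eq.mp hi with hlt | rfl
    · rw [hagree i hlt]; exact h.map_eq i hlt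
    · rw [hnew, hπρ]
  · intro s hs
    -- Only the trace of `s` on indices below `n` matters, and `hEρ` needs a subset of that range.
    set t := s ∩ Finset.range n
    have ht : t ∈ (Finset.range n).powerset := Finset.mem_powerset.mpr Finset.inter_subset_right
    have hst : ∀ i < n, i ∈ s ↔ i ∈ t := fun i hi => by simp [t, hi]
    have hpt : projAtom p s n = projAtom p t n := projAtom_congr (fun _ _ => rfl) hst
    have hPt : projAtom (Function.update P n ρ) s n = projAtom P t n := projAtom_congr hagree hst
    by_cases hn : n ∈ s
    · rw [projAtom_succ_of_mem _ hn] at hs ⊢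
      rw [hPt, hnew, hEρ t ht]
      exact hr0 t (hpt ▸ hs)
    · rw [projAtom_succ_of_notMem _ hn] at hs ⊢
      rw [hPt, hnew, mul_sub, mul_one, hEρ t ht]
      exact hr1 t (hpt ▸ hs)

/-- A sequence of commuting projections has a lift all of whose initial segments are faithful. -/
theorem exists_faithfulLift_seq [Nontrivial M] (hB : SelfAdjointUnitsDense B) {π : B →⋆ₐ[ℂ] M}
    (hπ : Function.Surjective π) {p : ℕ → M} (hp : ∀ n, CommutingProjections p n) :
    ∃ P : ℕ → B, ∀ n, FaithfulLift π p P n := by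
  choose next hnext hagree using fun (n : ℕ) (P : {P : ℕ → B // FaithfulLift π p P n}) =>
    P.2.exists_succ hB hπ (hp (n + 1))
  let seq : ∀ n, {P : ℕ → B // FaithfulLift π p P n} := fun n =>
    Nat.rec ⟨fun _ => 0, FaithfulLift.zero π p _⟩ (fun n P => ⟨next n P, hnext n P⟩) n
  have hstep : ∀ n, ∀ i < n, (seq (n + 1)).1 i = (seq n).1 i := fun n => hagree n (seq n)
  have hseq : ∀ n, ∀ i < n, (seq n).1 i = (seq (i + 1)).1 i := by
    intro n i hi
    induction n, hi using Nat.le_induction with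
    | base => rfl
    | succ m hm ih => rw [hstep m i hm, ih]
  -- Stage `i + 1` is the first to fix index `i`; later stages never change it.
  exact ⟨fun i => (seq (i + 1)).1 i, fun n => (seq n).2.congr (hseq n)⟩

end Lift

/-! ### From faithful lifts to cross sections and back. -/

section CrossSection

variable {B : Type u} [CStarAlgebra B] {M : Type v} [CStarAlgebra M]

/-- A ⋆-homomorphism that is isometric on the ⋆-algebra generated by `Z` can be inverted on the
C⋆-algebra generated by the image of `Z`. -/
theorem exists_crossSection_of_norm_map (π : B →⋆ₐ[ℂ] M) {Z : Set B} {Y : Set M}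
    (hY : Y = π '' Z) (hZ : ∀ x ∈ StarAlgebra.adjoin ℂ Z, ‖π x‖ = ‖x‖) :
    ∃ γ : cstarAdjoin Y →⋆ₐ[ℂ] B, IsUnitalCrossSection π (cstarAdjoin Y) γ ∧
      ∀ (y : cstarAdjoin Y), ∀ z ∈ cstarAdjoin Z, π z = y → γ y = z := by
  subst hY
  have hclosed : IsClosed (cstarAdjoin Z : Set B) := StarSubalgebra.isClosed_topologicalClosure _
  have hT : ∀ x ∈ cstarAdjoin Z, ‖π x‖ = ‖x‖ := by
    intro x hx
    have hc : IsClosed {x : B | ‖π x‖ = ‖x‖} :=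
      isClosed_eq π.continuous_of_cstar.norm continuous_norm
    exact closure_minimal (fun y hy => hZ y hy) hc hx
  set f : cstarAdjoin Z →⋆ₐ[ℂ] M := π.comp (cstarAdjoin Z).subtype
  have hf : Isometry f := AddMonoidHomClass.isometry_of_norm f fun x => hT x x.2
  have hcomplete : CompleteSpace (cstarAdjoin Z) := hclosed.completeSpace_coe
  -- An isometric image of a complete space is closed, so the range contains the whole C⋆-algebra
  -- generated by the image of `Z`, and `f` can be inverted there.
  have hrange : IsClosed (f.range : Set M) := by
    have : (f.range : Set M) = Set.range f := Set.ext fun _ => Iff.rfl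
    rw [this]
    exact hf.isClosedEmbedding.isClosed_range
  have hle : cstarAdjoin (π '' Z) ≤ f.range := by
    refine StarSubalgebra.topologicalClosure_minimal ?_ hrange
    refine StarAlgebra.adjoin_le ?_
    rintro _ ⟨z, hz, rfl⟩
    exact ⟨⟨z, StarSubalgebra.le_topologicalClosure _ (StarAlgebra.subset_adjoin ℂ Z hz)⟩, rfl⟩
  set E := StarAlgEquiv.ofInjective f hf.injective
  have hE : ∀ y : f.range, f (E.symm y) = y := fun y =>
    congrArg Subtype.val (E.apply_symm_apply y)
  refine ⟨((cstarAdjoin Z).subtype.comp (E.symm : f.range →⋆ₐ[ℂ] cstarAdjoin Z)).comp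
    (StarSubalgebra.inclusion hle), fun y => hE ⟨y, hle y.2⟩, fun y z hz hzy => ?_⟩
  have : E.symm ⟨y, hle y.2⟩ = ⟨z, hz⟩ := hf.injective ((hE _).trans hzy.symm)
  exact congrArg Subtype.val this

theorem FaithfulLift.norm_map {π : B →⋆ₐ[ℂ] M} {p : ℕ → M} {P : ℕ → B} {n : ℕ}
    (h : FaithfulLift π p P n) {x : B} (hx : x ∈ StarAlgebra.adjoin ℂ (P '' Set.Iio n)) :
    ‖π x‖ = ‖x‖ :=
  h.commutingProjections.norm_map_adjoin π
    (fun s hs => h.atom_eq_zero s (h.map_projAtom s ▸ hs)) hx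

theorem mem_adjoin_image_Iio (P : ℕ → B) {x : B} (hx : x ∈ StarAlgebra.adjoin ℂ (Set.range P)) :
    ∃ n, x ∈ StarAlgebra.adjoin ℂ (P '' Set.Iio n) := by
  have hmono : Monotone fun n => StarAlgebra.adjoin ℂ (P '' Set.Iio n) := fun m n hmn =>
    StarAlgebra.adjoin_mono (Set.image_mono (Set.Iio_subset_Iio hmn))
  have hle : StarAlgebra.adjoin ℂ (Set.range P) ≤
      ⨆ n, StarAlgebra.adjoin ℂ (P '' Set.Iio n) := by
    refine StarAlgebra.adjoin_le ?_
    rintro _ ⟨i, rfl⟩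
    exact le_iSup (fun n => StarAlgebra.adjoin ℂ (P '' Set.Iio n)) (i + 1)
      (StarAlgebra.subset_adjoin ℂ _ ⟨i, Nat.lt_succ_self i, rfl⟩)
  have := hle hx
  rw [← SetLike.mem_coe, StarSubalgebra.coe_iSup_of_directed hmono.directed_le] at this
  exact Set.mem_iUnion.mp this

/-- Cross sections on the C⋆-algebra generated by countably many commuting projections. -/
theorem exists_crossSection_of_countable [Nontrivial M] (hB : SelfAdjointUnitsDense B)
    {π : B →⋆ₐ[ℂ] M} (hπ : Function.Surjective π) {ι : Type w} [Countable ι] {p : ι → M}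
    (hp : ∀ i, IsStarProjection (p i)) (hc : ∀ i j, Commute (p i) (p j)) :
    ∃ γ : cstarAdjoin (Set.range p) →⋆ₐ[ℂ] B,
      IsUnitalCrossSection π (cstarAdjoin (Set.range p)) γ := by
  obtain ⟨f, hf⟩ := Countable.exists_injective_nat ι
  -- Indices outside the image of `f` receive the projection 0, which commutes with everything.
  set q : ℕ → M := Function.extend f p 0
  have hq : ∀ n, q n = 0 ∨ ∃ i, q n = p i := by
    intro n
    by_cases hn : ∃ i, f i = n
    · obtain ⟨i, rfl⟩ := hn
      exact Or.inr ⟨i, hf.extend_apply _ _ _⟩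
    · exact Or.inl (Function.extend_apply' _ _ _ hn)
  obtain ⟨Q, hQ⟩ := exists_faithfulLift_seq hB hπ (p := q) fun n => by
    refine ⟨fun i _ => ?_, fun i _ j _ => ?_⟩
    · rcases hq i with h | ⟨k, h⟩ <;> rw [h]
      · exact IsStarProjection.zero M
      · exact hp k
    · rcases hq i with h | ⟨k, h⟩
      · exact h ▸ Commute.zero_left (q j)
      rcases hq j with h' | ⟨l, h'⟩
      · exact h' ▸ Commute.zero_right (q i)
      · exact h ▸ h' ▸ hc k l
  have hY : Set.range p = π '' Set.range (Q ∘ f) := by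
    rw [← Set.range_comp]
    congr 1
    funext i
    have := (hQ (f i + 1)).map_eq (f i) (Nat.lt_succ_self _)
    simp only [Function.comp_apply, this, q, hf.extend_apply]
  obtain ⟨γ, hγ, -⟩ := exists_crossSection_of_norm_map π hY fun x hx => by
    obtain ⟨n, hn⟩ := mem_adjoin_image_Iio Q
      (StarAlgebra.adjoin_mono (Set.range_comp_subset_range f Q) hx)
    exact (hQ n).norm_map hn
  exact ⟨γ, hγ⟩

theorem cstarAdjoin_hom_ext {S : Set M} {φ ψ : cstarAdjoin S →⋆ₐ[ℂ] B}
    (h : ∀ x : cstarAdjoin S, (x : M) ∈ S → φ x = ψ x) : φ = ψ := by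
  have hcl : IsClosed (cstarAdjoin S : Set M) := StarSubalgebra.isClosed_topologicalClosure _
  exact StarAlgHom.ext_topologicalClosure (StarAlgHom.continuous_of_cstar φ)
    (StarAlgHom.continuous_of_cstar ψ) (StarAlgHom.ext_adjoin fun x hx => h _ hx)

theorem subset_cstarAdjoin (S : Set M) : S ⊆ cstarAdjoin S :=
  (StarAlgebra.subset_adjoin ℂ S).trans (StarSubalgebra.le_topologicalClosure _)

theorem coe_starSubalgebra_inclusion {S T : StarSubalgebra ℂ M} (h : S ≤ T) (x : S) :
    (StarSubalgebra.inclusion h x : M) = x :=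
  rfl

/-- The images of a sequence of generators under a cross section form a faithful lift. -/
theorem IsUnitalCrossSection.faithfulLift {π : B →⋆ₐ[ℂ] M} {S : StarSubalgebra ℂ M}
    {γ : S →⋆ₐ[ℂ] B} (hγ : IsUnitalCrossSection π S γ) {p : ℕ → M} {n : ℕ}
    (hp : CommutingProjections p n) {g : ℕ → S} (hg : ∀ i < n, (g i : M) = p i) :
    FaithfulLift π p (fun i => γ (g i)) n := by
  have hatom : ∀ s, ((projAtom g s n : S) : M) = projAtom p s n := fun s =>
    (map_projAtom S.subtype g s n).trans (projAtom_congr hg fun _ _ => Iff.rfl)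
  have hgp : CommutingProjections g n :=
    ⟨fun i hi => ⟨Subtype.ext (by
        simpa [hg i hi] using (hp.1 i hi).isIdempotentElem.eq), Subtype.ext (by
        simpa [hg i hi] using (hp.1 i hi).isSelfAdjoint.star_eq)⟩,
      fun i hi j hj => Subtype.ext (by
        simpa [hg i hi, hg j hj] using (hp.2 i hi j hj).eq)⟩
  exact
    { commutingProjections := ⟨fun i hi => (hgp.1 i hi).map γ,
        fun i hi j hj => (hgp.2 i hi j hj).map γ⟩
      map_eq := fun i hi => (hγ _).trans (hg i hi)
      atom_eq_zero := fun s hs => by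
        -- An atom that vanishes in `M` is already 0 in `S`, so `γ` kills it: faithfulness is
        -- automatic.
        have h0 : projAtom g s n = 0 := Subtype.ext ((hatom s).trans hs)
        rw [← map_projAtom γ g s n, h0, map_zero] }

/-- A cross section on the C⋆-algebra generated by finitely many commuting projections extends
when one more projection is added. -/
theorem exists_crossSection_extension (hB : SelfAdjointUnitsDense B)
    {π : B →⋆ₐ[ℂ] M} (hπ : Function.Surjective π) {p : ℕ → M} {n : ℕ}
    (hp : CommutingProjections p (n + 1)) {Y Y' : Set M} (hY : Y = p '' Set.Iio n)
    (hY' : Y' = p '' Set.Iio (n + 1)) (hle : cstarAdjoin Y ≤ cstarAdjoin Y')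
    (γ : cstarAdjoin Y →⋆ₐ[ℂ] B) (hγ : IsUnitalCrossSection π (cstarAdjoin Y) γ) :
    ∃ γ' : cstarAdjoin Y' →⋆ₐ[ℂ] B, IsUnitalCrossSection π (cstarAdjoin Y') γ' ∧
      γ'.comp (StarSubalgebra.inclusion hle) = γ := by
  have hmem : ∀ i < n, p i ∈ cstarAdjoin Y := fun i hi =>
    subset_cstarAdjoin _ (hY ▸ ⟨i, hi, rfl⟩)
  obtain ⟨g, hg⟩ : ∃ g : ℕ → cstarAdjoin Y, ∀ i < n, (g i : M) = p i :=
    ⟨fun i => if hi : i < n then ⟨p i, hmem i hi⟩ else 0, fun i hi => by simp [hi]⟩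
  obtain ⟨Q, hQ, hQP⟩ := (hγ.faithfulLift (hp.mono n.le_succ) hg).exists_succ hB hπ hp
  have hYQ : Y' = π '' (Q '' Set.Iio (n + 1)) := by
    rw [hY', Set.image_image]
    exact Set.image_congr fun i hi => (hQ.map_eq i hi).symm
  -- `huniq` forces `γ'` to send each `p i` to `Q i`, which is `γ (g i)` for `i < n`; agreement on
  -- generators then gives the restriction.
  obtain ⟨γ', hγ', huniq⟩ := exists_crossSection_of_norm_map π hYQ fun x hx => hQ.norm_map hx
  refine ⟨γ', hγ', cstarAdjoin_hom_ext fun x hx => ?_⟩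
  obtain ⟨i, hi, hix⟩ : (x : M) ∈ p '' Set.Iio n := hY.subset hx
  have hx' : x = g i := Subtype.ext (hix.symm.trans (hg i hi).symm)
  have hi' : i < n + 1 := Nat.lt_succ_of_lt hi
  have h1 : Q i = γ (g i) := hQP i hi
  have h2 : Q i ∈ cstarAdjoin (Q '' Set.Iio (n + 1)) := subset_cstarAdjoin _ ⟨i, hi', rfl⟩
  rw [StarAlgHom.comp_apply, hx', ← h1]
  refine huniq _ _ h2 ?_
  rw [coe_starSubalgebra_inclusion, hg i hi, hQ.map_eq i hi']

end CrossSection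

/-! ### Density of self-adjoint units in von Neumann algebras. -/

section VonNeumann

/-- Right annihilators in a von Neumann algebra are generated by projections. -/
theorem VonNeumannAlgebra.exists_projection_annihilator {H : Type u} [NormedAddCommGroup H]
    [InnerProductSpace ℂ H] [CompleteSpace H] (N : VonNeumannAlgebra H) {x : H →L[ℂ] H}
    (hx : x ∈ N) : ∃ e ∈ N, IsStarProjection e ∧ x * e = 0 ∧ ∀ y, x * y = 0 → e * y = y := by
  have hcl : IsClosed (x.ker : Set H) := x.isClosed_ker
  have : CompleteSpace x.ker := hcl.completeSpace_coe
  refine ⟨x.ker.starProjection, ?_, isStarProjection_starProjection, ?_, ?_⟩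
  · rw [VonNeumannAlgebra.IsStarProjection.mem_iff isStarProjection_starProjection]
    intro y hy
    rw [Submodule.range_starProjection]
    intro h hh
    have hxy : x * y = y * x := VonNeumannAlgebra.mem_commutant_iff.mp hy x hx
    have h0 : x h = 0 := hh
    have : x (y h) = y (x h) := congrArg (fun T : H →L[ℂ] H => T h) hxy
    change x (y h) = 0
    rw [this, h0, map_zero]
  · ext h
    exact (x.ker.starProjection_apply_mem h :)
  · intro y hxy
    ext h
    have : y h ∈ x.ker := congrArg (fun T : H →L[ℂ] H => T h) hxy
    exact Submodule.starProjection_eq_self_iff.mpr this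

theorem IsVonNeumann.exists_projection_annihilator {B : Type u} [CStarAlgebra B]
    (h : IsVonNeumann B) (x : B) :
    ∃ e : B, IsStarProjection e ∧ x * e = 0 ∧ ∀ y, x * y = 0 → e * y = y := by
  obtain ⟨H, _, _, _, N, ⟨Φ⟩⟩ := h
  obtain ⟨e, heN, he, hxe, hy⟩ := N.exists_projection_annihilator (x := (Φ x : H →L[ℂ] H)) (Φ x).2
  have hΦ : Φ (Φ.symm ⟨e, heN⟩) = ⟨e, heN⟩ := Φ.apply_symm_apply _
  refine ⟨Φ.symm ⟨e, heN⟩, ?_, ?_, fun y hxy => ?_⟩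
  · have : IsStarProjection (⟨e, heN⟩ : N.toStarSubalgebra) :=
      ⟨Subtype.ext he.isIdempotentElem, Subtype.ext he.isSelfAdjoint⟩
    exact this.map Φ.symm
  · apply EquivLike.injective Φ
    rw [map_mul, hΦ, map_zero]
    exact Subtype.ext hxe
  · apply EquivLike.injective Φ
    rw [map_mul, hΦ]
    refine Subtype.ext (hy _ ?_)
    have := congrArg Φ hxy
    rw [map_mul, map_zero] at this
    exact congrArg Subtype.val this

/-- Write `a = p - m` with positive and negative parts. The annihilator projection `e` of `p` fixes
`m`, so the symmetry `s = 1 - 2e` satisfies `a s = |a|`. Then `(a + ε s) s = |a| + ε` is invertible,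
hence so is `a + ε s`, which tends to `a`. -/
theorem IsVonNeumann.selfAdjointUnitsDense {B : Type u} [CStarAlgebra B] (h : IsVonNeumann B) :
    SelfAdjointUnitsDense B := by
  intro a ha
  set p : B := cfc (fun t : ℝ => max t 0) a with hp
  set m : B := cfc (fun t : ℝ => max (-t) 0) a with hm
  have hms : IsSelfAdjoint m := cfc_predicate _ _
  have hpm : p * m = 0 := by
    rw [hp, hm, ← cfc_mul _ _ a (by fun_prop) (by fun_prop), ← cfc_zero ℝ a]
    refine cfc_congr fun t _ => ?_
    rcases le_total t 0 with ht | ht <;> simp [ht]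
  have ha' : a = p - m := by
    rw [hp, hm, ← cfc_sub _ _ a (by fun_prop) (by fun_prop)]
    conv_lhs => rw [← cfc_id' ℝ a]
    refine cfc_congr fun t _ => ?_
    rcases le_total t 0 with ht | ht <;> simp [ht]
  have habs : ∀ ε : ℝ, p + m + algebraMap ℝ B ε = cfc (fun t : ℝ => |t| + ε) a := fun ε => by
    rw [cfc_add a _ _ (by fun_prop) (by fun_prop), cfc_const ε a, hp, hm,
      ← cfc_add a _ _ (by fun_prop) (by fun_prop)]
    congr 1
    refine cfc_congr fun t _ => ?_
    rcases le_total t 0 with ht | ht <;> simp [ht, abs_of_nonpos, abs_of_nonneg]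
  obtain ⟨e, he, hpe, hann⟩ := h.exists_projection_annihilator p
  have hee : e * e = e := he.isIdempotentElem
  have hem : e * m = m := hann m hpm
  have hme : m * e = m := by
    have := congrArg star hem
    rwa [star_mul, hms.star_eq, he.isSelfAdjoint.star_eq] at this
  have hss : (1 - 2 * e) * (1 - 2 * e) = 1 := by
    have : (1 - 2 * e) * (1 - 2 * e) = 1 - 4 * e + 4 * (e * e) := by noncomm_ring
    rw [this, hee, sub_add_cancel]
  have hs : IsSelfAdjoint (1 - 2 * e) := by
    rw [two_mul]
    exact (IsSelfAdjoint.one B).sub (he.isSelfAdjoint.add he.isSelfAdjoint)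
  have hcont : Continuous fun ε : ℝ => a + algebraMap ℝ B ε * (1 - 2 * e) := by fun_prop
  have h0 : (0 : ℝ) ∈ closure (Set.Ioi (0 : ℝ)) := by rw [closure_Ioi]; exact Set.self_mem_Ici
  have hmem := image_closure_subset_closure_image hcont (Set.mem_image_of_mem _ h0)
  simp only [map_zero, zero_mul, add_zero] at hmem
  refine closure_mono ?_ hmem
  rintro _ ⟨ε, hε, rfl⟩
  have hε : 0 < ε := hε
  refine ⟨ha.add ?_, ?_⟩
  · rw [← Algebra.smul_def]
    exact (IsSelfAdjoint.all ε).smul hs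
  · have hmul : (a + algebraMap ℝ B ε * (1 - 2 * e)) * (1 - 2 * e) =
        cfc (fun t : ℝ => |t| + ε) a := by
      rw [← habs, add_mul, mul_assoc, hss, mul_one, ha']
      have : (p - m) * (1 - 2 * e) = p - m - 2 * (p * e) + 2 * (m * e) := by noncomm_ring
      rw [this, hpe, hme]
      noncomm_ring
    have hu : IsUnit (cfc (fun t : ℝ => |t| + ε) a) := by
      rw [isUnit_cfc_iff _ a (by fun_prop)]
      intro t _
      positivity
    have hsu : IsUnit (1 - 2 * e) := ⟨⟨_, _, hss, hss⟩, rfl⟩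
    rw [← hmul] at hu
    obtain ⟨s, hs'⟩ := hsu
    change IsUnit (a + algebraMap ℝ B ε * (1 - 2 * e))
    rw [← hs'] at hu ⊢
    exact (Units.isUnit_mul_units _ s).mp hu

end VonNeumann

/-! ### Continuous functions on a totally disconnected space. -/

section TotallyDisconnected

variable {K : Type w} [MetricSpace K] [CompactSpace K] [TotallyDisconnectedSpace K]

/-- The indicator function of a clopen set. -/
noncomputable def clopenIndicator {K : Type w} [TopologicalSpace K]
    (U : TopologicalSpace.Clopens K) : C(K, ℂ) :=
  ⟨Set.indicator (U : Set K) 1, U.isClopen.continuous_indicator continuous_one⟩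

theorem isStarProjection_clopenIndicator {K : Type w} [TopologicalSpace K]
    (U : TopologicalSpace.Clopens K) : IsStarProjection (clopenIndicator U) := by
  constructor
  · ext x
    by_cases h : x ∈ (U : Set K) <;> simp [clopenIndicator, h]
  · ext x
    by_cases h : x ∈ (U : Set K) <;> simp [clopenIndicator, h]

theorem cstarAdjoin_clopenIndicator :
    cstarAdjoin (Set.range (clopenIndicator (K := K))) = ⊤ := by
  refine ContinuousMap.starSubalgebra_topologicalClosure_eq_top_of_separatesPoints _ ?_
  intro x y hxy
  obtain ⟨U, hU, hxU, hyU⟩ := exists_isClopen_of_totally_separated hxy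
  refine ⟨_, ⟨clopenIndicator ⟨U, hU⟩, StarAlgebra.subset_adjoin ℂ _ ⟨_, rfl⟩, rfl⟩, ?_⟩
  have hyU' : y ∉ U := hyU
  simp [clopenIndicator, hxU, hyU']

/-- A compact metric space has only countably many clopen sets. Their indicators generate `C(K, ℂ)`
by Stone–Weierstrass and map to commuting projections, so `φ` followed by a cross section on the
algebra they generate is a lift. -/
theorem SelfAdjointUnitsDense.exists_lift_continuousMap [Nonempty K] {B : Type u} [CStarAlgebra B]
    {M : Type v} [CStarAlgebra M] (hB : SelfAdjointUnitsDense B) {π : B →⋆ₐ[ℂ] M}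
    (hπ : Function.Surjective π) (φ : C(K, ℂ) →⋆ₐ[ℂ] M) :
    ∃ ψ : C(K, ℂ) →⋆ₐ[ℂ] B, π.comp ψ = φ := by
  -- If `M = 0`, any unital map lifts: evaluate at a point of `K` and embed the scalars in `B`.
  rcases subsingleton_or_nontrivial M with hM | hM
  · obtain ⟨k⟩ := ‹Nonempty K›
    exact ⟨(StarAlgHom.ofId ℂ B).comp (ContinuousMap.evalStarAlgHom ℂ ℂ k),
      StarAlgHom.ext fun _ => Subsingleton.elim _ _⟩
  have : Countable (TopologicalSpace.Clopens K) :=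
    TopologicalSpace.Clopens.countable_iff_secondCountable.mpr inferInstance
  set p : TopologicalSpace.Clopens K → M := fun U => φ (clopenIndicator U)
  obtain ⟨γ, hγ⟩ := exists_crossSection_of_countable hB hπ (p := p)
    (fun U => (isStarProjection_clopenIndicator U).map φ)
    (fun U V => (Commute.all (clopenIndicator U) (clopenIndicator V)).map φ)
  have hrange : ∀ f, φ f ∈ cstarAdjoin (Set.range p) := by
    have hcl : IsClosed ((cstarAdjoin (Set.range p)).comap φ : Set C(K, ℂ)) :=
      (StarSubalgebra.isClosed_topologicalClosure _).preimage φ.continuous_of_cstar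
    have hle : cstarAdjoin (Set.range (clopenIndicator (K := K))) ≤
        (cstarAdjoin (Set.range p)).comap φ := by
      refine StarSubalgebra.topologicalClosure_minimal (StarAlgebra.adjoin_le ?_) hcl
      rintro _ ⟨U, rfl⟩
      exact subset_cstarAdjoin _ ⟨U, rfl⟩
    rw [cstarAdjoin_clopenIndicator] at hle
    exact fun f => hle StarSubalgebra.mem_top
  exact ⟨γ.comp (φ.codRestrict _ hrange), StarAlgHom.ext fun f => hγ ⟨φ f, hrange f⟩⟩

end TotallyDisconnected

theorem theorem4p3 :
    (∀ (B : Type u) [CStarAlgebra B] (M : Type v) [CStarAlgebra M] [Nontrivial M],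
      RealRankZero B → ∀ π : B →⋆ₐ[ℂ] M, Function.Surjective π →
        (∀ (ι : Type w) [Countable ι] (p : ι → M), (∀ i, IsStarProjection (p i)) →
          (∀ i j, Commute (p i) (p j)) →
            ∃ γ : cstarAdjoin (Set.range p) →⋆ₐ[ℂ] B,
              IsUnitalCrossSection π (cstarAdjoin (Set.range p)) γ) ∧
        (∀ p : ℕ → M, (∀ i, IsStarProjection (p i)) → (∀ i j, Commute (p i) (p j)) →
          ∀ (n : ℕ) (γ : cstarStage p n →⋆ₐ[ℂ] B), IsUnitalCrossSection π (cstarStage p n) γ →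
            ∃ γ' : cstarStage p (n + 1) →⋆ₐ[ℂ] B,
              IsUnitalCrossSection π (cstarStage p (n + 1)) γ' ∧
              γ'.comp (StarSubalgebra.inclusion (cstarStage_le_succ p n)) = γ)) ∧
    (∀ (K : Type w) [MetricSpace K] [CompactSpace K] [TotallyDisconnectedSpace K] [Nonempty K],
      RR0Projective.{u, v, w} C(K, ℂ) ∧ WStarCStarProjective.{u, v, w} C(K, ℂ)) := by
  refine ⟨fun B _ M _ _ hB π hπ => ⟨fun ι _ p hp hc => ?_, fun p hp hc n γ hγ => ?_⟩,
    fun K _ _ _ _ => ⟨?_, ?_⟩⟩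
  · exact exists_crossSection_of_countable hB.selfAdjointUnitsDense hπ hp hc
  · exact exists_crossSection_extension hB.selfAdjointUnitsDense hπ
      ⟨fun i _ => hp i, fun i _ j _ => hc i j⟩ rfl rfl (cstarStage_le_succ p n) γ hγ
  · exact fun B _ M _ hB _ π hπ φ => hB.selfAdjointUnitsDense.exists_lift_continuousMap hπ φ
  · exact fun B _ M _ hB _ π hπ φ => hB.selfAdjointUnitsDense.exists_lift_continuousMap hπ φ
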